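/- Let $G$ be a finite simple graph. A tree decomposition of $G$ consists of a finite tree $T$ and bags $X_t\subseteq V(G)$ ($t\in V(T)$) such that every vertex of $G$ lies in some bag, both ends of every edge of $G$ lie in a common bag, and $X_a\cap X_b\subseteq X_s$ whenever $s$ is on the path of $T$ between $a$ and $b$. The treewidth $\mathrm{tw}(G)$ is the least integer $k\ge 0$ such that $G$ has a tree decomposition with $|X_t|\le k+1$ for all $t$. For an injection $L\colon V(G)\to\mathbb N$ (a linear order of $V(G)$) and an integer $r\ge 0$, a vertex $u$ is weakly $r$-reachable from $v$ if there is a path from $v$ to $u$ of length at most $r$ (possibly $0$) all of whose vertices $w$ satisfy $L(u)\le L(w)$; $\mathrm{WReach}_r[G,L,v]$ denotes the set of these $u$. The weak $r$-colouring number is $$\mathrm{wcol}_r(G)=\min_{L}\max_{v\in V(G)}|\mathrm{WReach}_r[G,L,v]|.$$ **Theorem.** For all integers $k\ge 0$ and $r\ge 0$ there is a finite simple graph $G^k_r$ with $\mathrm{tw}(G^k_r)=k$ such that, for every integer $r'$ with $0\le r'\le r$, $$\mathrm{wcol}_{r'}(G^k_r)=\binom{r'+k}{k}.$$ In particular $\mathrm{wcol}_r(G^k_r)=\binom{r+k}{k}$.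 -/

import Mathlib

namespace SimpleGraph

/-- A tree decomposition of `G` over the (finite) tree `T`: a family of bags, indexed by the nodes
of `T`, which cover all vertices and all edges, and such that every bag on the path of `T` between
two nodes contains the intersection of the bags at these two nodes. -/
structure TreeDecomposition {V : Type*} (G : SimpleGraph V) {ι : Type*} (T : SimpleGraph ι) where
  isTree : T.IsTree
  bag : ι → Finset V
  cover_vertex : ∀ v : V, ∃ t, v ∈ bag t
  cover_edge : ∀ u v : V, G.Adj u v → ∃ t, u ∈ bag t ∧ v ∈ bag t
  inter_subset : ∀ (a s b : ι) (p : T.Walk a b), p.IsPath → s ∈ p.support →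
    ∀ v : V, v ∈ bag a → v ∈ bag b → v ∈ bag s

/-- `G` has treewidth at most `k`: some tree decomposition of `G` over a finite tree has all its
bags of size at most `k + 1`. -/
def TreewidthAtMost {V : Type*} (G : SimpleGraph V) (k : ℕ) : Prop :=
  ∃ (ι : Type) (_ : Finite ι) (T : SimpleGraph ι) (D : G.TreeDecomposition T),
    ∀ t, (D.bag t).card ≤ k + 1

/-- The treewidth of a (finite) graph: the least `k` such that it has treewidth at most `k`. -/
noncomputable def treewidth {V : Type*} (G : SimpleGraph V) : ℕ :=
  sInf {k | G.TreewidthAtMost k}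

/-- The minimum in the definition of the treewidth of a finite graph is attained. -/
theorem treewidthAtMost_treewidth {V : Type*} [Fintype V] (G : SimpleGraph V) :
    G.TreewidthAtMost G.treewidth := by
  refine Nat.sInf_mem (s := {k | G.TreewidthAtMost k}) ⟨Fintype.card V, ?_⟩
  refine ⟨Unit, inferInstance, ⊥, ⟨IsTree.of_subsingleton, fun _ => Finset.univ, ?_, ?_, ?_⟩, ?_⟩
  · exact fun v => ⟨(), Finset.mem_univ v⟩
  · exact fun u v _ => ⟨(), Finset.mem_univ u, Finset.mem_univ v⟩
  · exact fun _ _ _ _ _ _ v _ _ => Finset.mem_univ v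
  · intro t
    exact (Finset.card_univ (α := V)).le.trans (Nat.le_succ _)

/-- `G.WReach L r v` is the set of vertices `u` that are weakly `r`-reachable from `v` with respect
to the order `L`: some path of length at most `r` (possibly `0`) from `v` to `u` has `u` as its
`L`-least vertex. -/
def WReach {V : Type*} (G : SimpleGraph V) (L : V → ℕ) (r : ℕ) (v : V) : Set V :=
  {u | ∃ p : G.Walk v u, p.IsPath ∧ p.length ≤ r ∧ ∀ w ∈ p.support, L u ≤ L w}

/-- The weak `r`-colouring number of a finite graph: the minimum over all linear orders of the
vertices, given as injections `L : V ↪ ℕ`, of the maximum over all vertices `v` of the number of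
vertices that are weakly `r`-reachable from `v`. -/
noncomputable def wcol {V : Type*} [Fintype V] (G : SimpleGraph V) (r : ℕ) : ℕ :=
  ⨅ L : V ↪ ℕ, Finset.univ.sup fun v : V => (G.WReach L r v).ncard

end SimpleGraph

/-!
Both bounds on `wcol` come from Pascal's rule. For the upper bound, order the vertices so that the
earlier neighbours of every vertex form a clique of size at most `k`. A weakly reachable vertex can
then be reached by moving only to earlier neighbours, since a detour through later vertices can be
shortcut within such a clique. Let `p` be the earliest of the earlier neighbours of `v`. Whatever
`v` reaches in `n + 1` steps up to `p` is reached from `p` in `n` steps, and whatever it reaches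
after `p` is reached along steps that stay after `p`, where the bound on the cliques drops to
`k - 1`.

For the lower bound, attach to every vertex of the extremal graph for `(k + 1, r)` many copies of
the extremal graph for `(k, r + 1)`. In any order, take a base vertex `x` from which the maximum
number of base vertices is weakly `r`-reachable. If every copy attached to `x` contains a vertex
before `x`, then `x` reaches all of these in one step. Otherwise some copy lies after `x`, and each
of its vertices weakly `(r + 1)`-reaches, through `x`, all that `x` weakly `r`-reaches in the base,
in addition to what it reaches within the copy.

An elimination order of width `k` gives a tree decomposition in which the parent of a vertex is its
latest earlier neighbour. The treewidth is not smaller than `k` if there is a clique of size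
`k + 1`, since every clique lies in a bag by the Helly property of subtrees.
-/

namespace WeakColouring

open SimpleGraph

section ReachWithin

/-- The elements reachable from `v` in at most `n` steps, where a step leads from `a` to an element
of `N a`. -/
def reachWithin {V : Type*} (N : V → Set V) : ℕ → V → Set V
  | 0, v => {v}
  | n + 1, v => insert v (⋃ a ∈ N v, reachWithin N n a)

/-- The sets `N v` behave like the sets of earlier neighbours in a perfect elimination order `L` of
width at most `k`: the earlier of two members of `N v` belongs to the set of the later one. -/
structure IsEliminationSystem {V α : Type*} [LinearOrder α] (L : V ↪ α) (N : V → Set V)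
    (k : ℕ) : Prop where
  lt_of_mem : ∀ {v a}, a ∈ N v → L a < L v
  mem_of_lt : ∀ {v a b}, a ∈ N v → b ∈ N v → L b < L a → b ∈ N a
  ncard_le : ∀ v, (N v).ncard ≤ k

/-- The steps of `N` that stay strictly above `p` and start at a vertex `v` with `p ∈ N v`. -/
def stepsAbove {V α : Type*} [LinearOrder α] (L : V ↪ α) (N : V → Set V) (p v : V) : Set V :=
  {a | a ∈ N v ∧ p ∈ N v ∧ L p < L a}

variable {V α : Type*} [LinearOrder α] {L : V ↪ α} {N : V → Set V} {k n : ℕ} {u v p : V}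

theorem mem_reachWithin_succ :
    u ∈ reachWithin N (n + 1) v ↔ u = v ∨ ∃ a ∈ N v, u ∈ reachWithin N n a := by
  simp [reachWithin]

theorem self_mem_reachWithin : v ∈ reachWithin N n v := by
  cases n <;> simp [reachWithin]

theorem reachWithin_subset_succ : reachWithin N n v ⊆ reachWithin N (n + 1) v := by
  induction n generalizing v with
  | zero => rintro u rfl; exact self_mem_reachWithin
  | succ n ih =>
    intro u hu
    rcases mem_reachWithin_succ.1 hu with rfl | ⟨a, ha, hu⟩
    · exact self_mem_reachWithin
    · exact mem_reachWithin_succ.2 (.inr ⟨a, ha, ih hu⟩)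

theorem reachWithin_eq_singleton (h : N v = ∅) : reachWithin N n v = {v} := by
  cases n <;> simp [reachWithin, h]

theorem choose_add_succ (n k : ℕ) :
    (n + 1 + (k + 1)).choose (k + 1) = (n + (k + 1)).choose (k + 1) + (n + 1 + k).choose k := by
  rw [← add_assoc (n + 1), Nat.choose_succ_succ', add_comm, add_right_comm n 1 k, add_assoc n k 1]

namespace IsEliminationSystem

theorem le_of_mem_reachWithin (h : IsEliminationSystem L N k) (hu : u ∈ reachWithin N n v) :
    L u ≤ L v := by
  induction n generalizing v with
  | zero => exact (congrArg L hu).le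
  | succ n ih =>
    rcases mem_reachWithin_succ.1 hu with rfl | ⟨a, ha, hu⟩
    · exact le_rfl
    · exact (ih hu).trans (h.lt_of_mem ha).le

theorem mem_reachWithin_of_mem_of_le (h : IsEliminationSystem L N k) (hp : p ∈ N v)
    (hu : u ∈ reachWithin N n v) (hup : L u ≤ L p) : u ∈ reachWithin N n p := by
  induction n generalizing v with
  | zero =>
    obtain rfl : u = v := hu
    exact absurd (h.lt_of_mem hp) hup.not_gt
  | succ n ih =>
    rcases mem_reachWithin_succ.1 hu with rfl | ⟨a, ha, hua⟩
    · exact absurd (h.lt_of_mem hp) hup.not_gt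
    · rcases lt_trichotomy (L a) (L p) with hap | hap | hpa
      · exact mem_reachWithin_succ.2 (.inr ⟨a, h.mem_of_lt hp ha hap, hua⟩)
      · exact reachWithin_subset_succ (L.injective hap ▸ hua)
      · exact reachWithin_subset_succ (ih (h.mem_of_lt ha hp hpa) hua)

theorem mem_reachWithin_stepsAbove (h : IsEliminationSystem L N k) (hp : p ∈ N v)
    (hu : u ∈ reachWithin N n v) (hpu : L p < L u) :
    u ∈ reachWithin (stepsAbove L N p) n v := by
  induction n generalizing v with
  | zero => exact hu
  | succ n ih =>
    rcases mem_reachWithin_succ.1 hu with rfl | ⟨a, ha, hua⟩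
    · exact self_mem_reachWithin
    · have hpa : L p < L a := hpu.trans_le (h.le_of_mem_reachWithin hua)
      exact mem_reachWithin_succ.2
        (.inr ⟨a, ⟨ha, hp, hpa⟩, ih (h.mem_of_lt ha hp hpa) hua⟩)

theorem reachWithin_succ_subset_union (h : IsEliminationSystem L N k) (hp : p ∈ N v)
    (hmin : ∀ a ∈ N v, L p ≤ L a) :
    reachWithin N (n + 1) v ⊆
      reachWithin N n p ∪ reachWithin (stepsAbove L N p) (n + 1) v := by
  intro u hu
  rcases lt_or_ge (L p) (L u) with hpu | hup
  · exact .inr (h.mem_reachWithin_stepsAbove hp hu hpu)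
  left
  rcases mem_reachWithin_succ.1 hu with rfl | ⟨a, ha, hua⟩
  · exact absurd (h.lt_of_mem hp) hup.not_gt
  · rcases (hmin a ha).eq_or_lt with hpa | hpa
    · exact L.injective hpa ▸ hua
    · exact h.mem_reachWithin_of_mem_of_le (h.mem_of_lt ha hp hpa) hua hup

theorem stepsAbove [Finite V] (h : IsEliminationSystem L N (k + 1)) (p : V) :
    IsEliminationSystem L (stepsAbove L N p) k where
  lt_of_mem ha := h.lt_of_mem ha.1
  mem_of_lt ha hb hba := ⟨h.mem_of_lt ha.1 hb.1 hba, h.mem_of_lt ha.1 ha.2.1 ha.2.2, hb.2.2⟩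
  ncard_le v := by
    by_cases hp : p ∈ N v
    · have hss : WeakColouring.stepsAbove L N p v ⊂ N v :=
        ⟨fun a ha => ha.1, fun hsub => lt_irrefl _ (hsub hp).2.2⟩
      exact Nat.le_of_lt_succ ((Set.ncard_lt_ncard hss).trans_le (h.ncard_le v))
    · simp [WeakColouring.stepsAbove, hp]

theorem ncard_reachWithin_le [Finite V] (h : IsEliminationSystem L N k) (n : ℕ) (v : V) :
    (reachWithin N n v).ncard ≤ (n + k).choose k := by
  induction k generalizing N n v with
  | zero =>
    have hN : N v = ∅ := (Set.ncard_eq_zero (Set.toFinite _)).1 (Nat.le_zero.1 (h.ncard_le v))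
    simp [reachWithin_eq_singleton hN]
  | succ k ihk =>
    induction n generalizing v with
    | zero => simp [reachWithin]
    | succ n ihn =>
      rcases (N v).eq_empty_or_nonempty with hN | hN
      · rw [reachWithin_eq_singleton hN, Set.ncard_singleton]
        exact Nat.choose_pos (Nat.le_add_left _ _)
      obtain ⟨p, hp, hmin⟩ := Set.exists_min_image _ L (Set.toFinite _) hN
      calc (reachWithin N (n + 1) v).ncard
          ≤ (reachWithin N n p ∪ reachWithin (WeakColouring.stepsAbove L N p) (n + 1) v).ncard :=
            Set.ncard_le_ncard (h.reachWithin_succ_subset_union hp hmin)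
        _ ≤ (reachWithin N n p).ncard +
              (reachWithin (WeakColouring.stepsAbove L N p) (n + 1) v).ncard :=
            Set.ncard_union_le _ _
        _ ≤ (n + (k + 1)).choose (k + 1) + (n + 1 + k).choose k :=
            add_le_add (ihn p) (ihk (h.stepsAbove p) (n + 1) v)
        _ = (n + 1 + (k + 1)).choose (k + 1) := (choose_add_succ n k).symm

end IsEliminationSystem

end ReachWithin

section EliminationOrder

/-- The neighbours of `v` that precede `v` in the order `L`. -/
def earlierNeighbors {V α : Type*} [LT α] (G : SimpleGraph V) (L : V → α) (v : V) : Set V :=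
  {a | G.Adj v a ∧ L a < L v}

/-- `L` is a perfect elimination order of `G` of width at most `k`, read backwards: the earlier
neighbours of each vertex form a clique of size at most `k`. -/
structure IsEliminationOrder {V : Type*} (G : SimpleGraph V) (L : V ↪ ℕ) (k : ℕ) : Prop where
  isClique : ∀ v, G.IsClique (earlierNeighbors G L v)
  ncard_le : ∀ v, (earlierNeighbors G L v).ncard ≤ k

variable {V : Type*} {G : SimpleGraph V} {L : V ↪ ℕ} {k r : ℕ}

namespace IsEliminationOrder

theorem isEliminationSystem (h : IsEliminationOrder G L k) :
    IsEliminationSystem L (earlierNeighbors G L) k where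
  lt_of_mem ha := ha.2
  mem_of_lt ha hb hba := ⟨h.isClique _ ha hb (ne_of_apply_ne L hba.ne'), hba⟩
  ncard_le := h.ncard_le

theorem mem_reachWithin_of_walk (h : IsEliminationOrder G L k) {v u : V} (p : G.Walk v u)
    (hmin : ∀ w ∈ p.support, L u ≤ L w) {n : ℕ} (hn : p.length ≤ n) :
    u ∈ reachWithin (earlierNeighbors G L) n v := by
  induction p generalizing n with
  | nil => exact self_mem_reachWithin
  | @cons v w u hvw p ih =>
    rw [Walk.length_cons] at hn
    obtain ⟨n, rfl⟩ := Nat.exists_eq_add_one_of_ne_zero (Nat.ne_zero_of_lt hn)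
    have hw := ih (fun x hx => hmin x (List.mem_cons_of_mem _ hx)) (Nat.le_of_succ_le_succ hn)
    rcases (L.injective.ne hvw.ne).lt_or_gt with hlt | hgt
    · exact reachWithin_subset_succ (h.isEliminationSystem.mem_reachWithin_of_mem_of_le
        ⟨hvw.symm, hlt⟩ hw (hmin v List.mem_cons_self))
    · exact mem_reachWithin_succ.2 (.inr ⟨w, ⟨hvw, hgt⟩, hw⟩)

theorem wReach_subset_reachWithin (h : IsEliminationOrder G L k) (v : V) :
    G.WReach L r v ⊆ reachWithin (earlierNeighbors G L) r v := by
  rintro u ⟨p, -, hlen, hmin⟩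
  exact h.mem_reachWithin_of_walk p hmin hlen

theorem wcol_le [Fintype V] (h : IsEliminationOrder G L k) (r : ℕ) :
    G.wcol r ≤ (r + k).choose k :=
  (ciInf_le' _ L).trans <| Finset.sup_le fun v _ =>
    (Set.ncard_le_ncard (h.wReach_subset_reachWithin v)).trans
      (h.isEliminationSystem.ncard_reachWithin_le r v)

end IsEliminationOrder

theorem isEliminationOrder_top (k : ℕ) :
    IsEliminationOrder (⊤ : SimpleGraph (Fin (k + 1))) Fin.valEmbedding k where
  isClique _ := .top _
  ncard_le v := by
    have hss : earlierNeighbors (⊤ : SimpleGraph (Fin (k + 1))) Fin.valEmbedding v ⊂ Set.univ :=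
      (Set.ssubset_univ_iff_nonempty_compl).2 ⟨v, fun hv => hv.1.ne rfl⟩
    simpa [Nat.lt_succ_iff] using Set.ncard_lt_ncard hss

end EliminationOrder

section PathConvex

/-- A set of nodes is path-convex if it contains every path between two of its members. In a tree
these are the vertex sets of subtrees, together with `∅`. -/
def IsPathConvex {ι : Type*} (T : SimpleGraph ι) (S : Set ι) : Prop :=
  ∀ ⦃a⦄, a ∈ S → ∀ ⦃b⦄, b ∈ S → ∀ p : T.Walk a b, p.IsPath → ∀ t ∈ p.support, t ∈ S

variable {ι : Type*} {T : SimpleGraph ι}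

/-- The vertex `b` is the first member of `S` on `q`. -/
theorem IsPathConvex.exists_gate {S : Set ι} (hS : IsPathConvex T S) {a c : ι} (hc : c ∈ S)
    (q : T.Walk a c) : ∃ b ∈ S, ∀ y ∈ S, ∀ p : T.Walk a y, b ∈ p.support := by
  classical
  induction q with
  | nil => exact ⟨_, hc, fun y _ p => p.start_mem_support⟩
  | @cons a a' c h q ih =>
    by_cases ha : a ∈ S
    · exact ⟨a, ha, fun y _ p => p.start_mem_support⟩
    obtain ⟨b, hb, hgate⟩ := ih hc
    refine ⟨b, hb, fun y hy p => ?_⟩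
    by_contra hbp
    obtain rfl : b = a' :=
      (List.mem_cons.1 (hgate y hy (Walk.cons h.symm p))).resolve_right hbp
    -- otherwise the path from `b` through `a` to `y` would force `a ∈ S`
    have hpath : (Walk.cons h.symm p.bypass).IsPath :=
      p.bypass_isPath.cons fun hb' => hbp (p.support_bypass_subset_support hb')
    exact ha (hS hb hy _ hpath a (List.mem_cons_of_mem _ p.bypass.start_mem_support))

theorem exists_forall_mem_of_isPathConvex (hT : T.Connected) {κ : Type*} (s : Finset κ)
    (S : κ → Set ι) (hS : ∀ i ∈ s, IsPathConvex T (S i))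
    (hpair : ∀ i ∈ s, ∀ j ∈ s, (S i ∩ S j).Nonempty) : ∃ t, ∀ i ∈ s, t ∈ S i := by
  classical
  induction s using Finset.induction_on with
  | empty => exact ⟨hT.nonempty.some, by simp⟩
  | insert j s _ ih =>
    simp only [Finset.mem_insert, forall_eq_or_imp, Set.inter_self] at hS hpair
    obtain ⟨a, ha⟩ := ih hS.2 fun i hi => (hpair.2 i hi).2
    obtain ⟨c, hc⟩ := hpair.1.1
    obtain ⟨b, hb, hgate⟩ := hS.1.exists_gate hc (hT a c).some
    refine ⟨b, (Finset.forall_mem_insert _ _ _).2 ⟨hb, fun i hi => ?_⟩⟩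
    obtain ⟨y, hyj, hyi⟩ := hpair.1.2 i hi
    obtain ⟨p, hp⟩ := (hT a y).exists_isPath
    exact hS.2 i hi (ha i hi) hyi p hp b (hgate y hyj p)

theorem support_subset_of_isAcyclic (hT : T.IsAcyclic) {a b : ι} {p : T.Walk a b}
    (hp : p.IsPath) (q : T.Walk a b) : p.support ⊆ q.support := by
  classical
  obtain rfl : p = q.bypass :=
    congrArg Subtype.val ((hT.subsingleton_path a b).elim ⟨p, hp⟩ ⟨_, q.bypass_isPath⟩)
  exact q.support_bypass_subset_support

theorem isPathConvex_of_forall_exists_walk (hT : T.IsAcyclic) {S : Set ι} {c : ι}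
    (h : ∀ a ∈ S, ∃ q : T.Walk a c, ∀ t ∈ q.support, t ∈ S) : IsPathConvex T S := by
  intro a ha b hb p hp t ht
  obtain ⟨q, hq⟩ := h a ha
  obtain ⟨q', hq'⟩ := h b hb
  have ht' := support_subset_of_isAcyclic hT hp (q.append q'.reverse) ht
  rw [Walk.mem_support_append_iff, Walk.support_reverse, List.mem_reverse] at ht'
  exact ht'.elim (hq t) (hq' t)

end PathConvex

section TreewidthLowerBound

variable {V : Type*} {G : SimpleGraph V}

theorem exists_subset_bag_of_isClique {ι : Type*} {T : SimpleGraph ι} (D : G.TreeDecomposition T)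
    {s : Finset V} (hs : G.IsClique s) : ∃ t, s ⊆ D.bag t := by
  refine exists_forall_mem_of_isPathConvex D.isTree.1 s (fun v => {t | v ∈ D.bag t})
    (fun v _ a ha b hb p hp t ht => D.inter_subset a t b p hp ht v ha hb) fun u hu v hv => ?_
  by_cases huv : u = v
  · obtain ⟨t, ht⟩ := D.cover_vertex v
    exact ⟨t, huv ▸ ht, ht⟩
  · exact D.cover_edge u v (hs hu hv huv)

theorem le_of_treewidthAtMost_of_not_cliqueFree {k m : ℕ} (h : G.TreewidthAtMost k)
    (hG : ¬ G.CliqueFree (m + 1)) : m ≤ k := by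
  obtain ⟨ι, -, T, D, hcard⟩ := h
  simp only [CliqueFree, not_forall, not_not] at hG
  obtain ⟨s, hs⟩ := hG
  obtain ⟨t, ht⟩ := exists_subset_bag_of_isClique D hs.isClique
  have hle := (Finset.card_le_card ht).trans (hcard t)
  rw [hs.card_eq] at hle
  exact Nat.le_of_succ_le_succ hle

end TreewidthLowerBound

section ParentGraph

/-- The rooted forest in which `par v` is the parent of `v`, turned into a tree by the extra root
`none`, which is the parent of the vertices without a parent. -/
def parentGraph {V : Type*} (par : V → Option V) : SimpleGraph (Option V) :=
  fromEdgeSet (Set.range fun v => s(some v, par v))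

variable {V : Type*} {L : V → ℕ} {par : V → Option V}

theorem parentGraph_adj (hpar : ∀ v, ∀ w ∈ par v, L w < L v) (v : V) :
    (parentGraph par).Adj (some v) (par v) :=
  (fromEdgeSet_adj _).2 ⟨⟨v, rfl⟩, fun h => lt_irrefl _ (hpar v v h.symm)⟩

theorem parentGraph_reachable_none (hpar : ∀ v, ∀ w ∈ par v, L w < L v) (v : V) :
    (parentGraph par).Reachable (some v) none := by
  refine (parentGraph_adj hpar v).reachable.trans ?_
  match h : par v with
  | none => exact .rfl
  | some w =>
    have := hpar v w h
    exact parentGraph_reachable_none hpar w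
termination_by L v

theorem parentGraph_isTree [Finite V] (hpar : ∀ v, ∀ w ∈ par v, L w < L v) :
    (parentGraph par).IsTree := by
  have hroot : ∀ x, (parentGraph par).Reachable x none
    | none => .rfl
    | some v => parentGraph_reachable_none hpar v
  have hconn : (parentGraph par).Connected :=
    ⟨fun x y => (hroot x).trans (hroot y).symm⟩
  refine isTree_iff_connected_and_card.2
    ⟨hconn, le_antisymm ?_ hconn.card_vert_le_card_edgeSet_add_one⟩
  rw [Finite.card_option, add_le_add_iff_right]
  calc Nat.card (parentGraph par).edgeSet
      ≤ Nat.card (Set.range fun v => s(some v, par v)) :=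
        Nat.card_mono (Set.toFinite _) (edgeSet_fromEdgeSet _ ▸ Set.sdiff_subset)
    _ ≤ Nat.card V := Finite.card_range_le _

end ParentGraph

section EliminationTree

variable {V : Type*} [Finite V] {G : SimpleGraph V} {L : V ↪ ℕ} {k : ℕ} {v w x : V}

/-- The parent of `v` in the elimination tree: the latest earlier neighbour of `v`, if any. -/
noncomputable def eliminationParent (G : SimpleGraph V) (L : V → ℕ) (v : V) : Option V :=
  (Set.toFinite (earlierNeighbors G L v)).toFinset.toList.argmax L

open Classical in
/-- The bag at the node `v` of the elimination tree; the bag at the extra root is empty. -/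
noncomputable def eliminationBag (G : SimpleGraph V) (L : V → ℕ) : Option V → Finset V
  | none => ∅
  | some v => insert v (Set.toFinite (earlierNeighbors G L v)).toFinset

theorem eliminationParent_mem {L : V → ℕ} (h : w ∈ eliminationParent G L v) :
    w ∈ earlierNeighbors G L v := by
  simpa using List.argmax_mem h

theorem eliminationParent_lt (G : SimpleGraph V) (L : V → ℕ) (v : V) :
    ∀ w ∈ eliminationParent G L v, L w < L v :=
  fun _ hw => (eliminationParent_mem hw).2

theorem exists_mem_eliminationParent {L : V → ℕ} (hx : x ∈ earlierNeighbors G L v) :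
    ∃ w ∈ eliminationParent G L v, L x ≤ L w := by
  have hx' : x ∈ (Set.toFinite (earlierNeighbors G L v)).toFinset.toList := by simpa using hx
  obtain ⟨w, hw⟩ := Option.ne_none_iff_exists'.1
    (mt List.argmax_eq_none.1 (List.ne_nil_of_mem hx') : eliminationParent G L v ≠ none)
  exact ⟨w, hw, List.le_of_mem_argmax hx' hw⟩

theorem mem_eliminationBag_some {L : V → ℕ} :
    x ∈ eliminationBag G L (some v) ↔ x = v ∨ x ∈ earlierNeighbors G L v := by
  simp [eliminationBag]

/-- The parent graph of the latest earlier neighbours. -/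
noncomputable abbrev eliminationTree (G : SimpleGraph V) (L : V → ℕ) : SimpleGraph (Option V) :=
  parentGraph (eliminationParent G L)

theorem eliminationTree_isTree (G : SimpleGraph V) (L : V → ℕ) : (eliminationTree G L).IsTree :=
  parentGraph_isTree (eliminationParent_lt G L)

namespace IsEliminationOrder

theorem exists_parent_bag (h : IsEliminationOrder G L k) (hx : x ∈ earlierNeighbors G L v) :
    ∃ w ∈ eliminationParent G L v, x ∈ eliminationBag G L (some w) := by
  obtain ⟨w, hw, hxw⟩ := exists_mem_eliminationParent hx
  refine ⟨w, hw, mem_eliminationBag_some.2 ?_⟩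
  rcases hxw.eq_or_lt with heq | hlt
  · exact .inl (L.injective heq)
  · exact .inr (h.isEliminationSystem.mem_of_lt (eliminationParent_mem hw) hx hlt)

theorem exists_walk_of_mem_eliminationBag (h : IsEliminationOrder G L k) (v : V)
    (hx : x ∈ eliminationBag G L (some v)) :
    ∃ q : (eliminationTree G L).Walk (some v) (some x),
      ∀ t ∈ q.support, x ∈ eliminationBag G L t := by
  rcases mem_eliminationBag_some.1 hx with rfl | hxv
  · exact ⟨Walk.nil, by simpa using hx⟩
  obtain ⟨w, hw, hxw⟩ := h.exists_parent_bag hxv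
  obtain ⟨q, hq⟩ := h.exists_walk_of_mem_eliminationBag w hxw
  have hadj : (eliminationTree G L).Adj (some v) (eliminationParent G L v) :=
    parentGraph_adj (eliminationParent_lt G L) v
  rw [Option.mem_def.1 hw] at hadj
  exact ⟨Walk.cons hadj q, List.forall_mem_cons.2 ⟨hx, hq⟩⟩
termination_by L v
decreasing_by exact eliminationParent_lt G L v w hw

/-- The tree decomposition of `G` over the elimination tree. -/
noncomputable def treeDecomposition (h : IsEliminationOrder G L k) :
    G.TreeDecomposition (eliminationTree G L) where
  isTree := eliminationTree_isTree G L
  bag := eliminationBag G L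
  cover_vertex v := ⟨some v, mem_eliminationBag_some.2 (.inl rfl)⟩
  cover_edge u v huv := by
    rcases (L.injective.ne huv.ne).lt_or_gt with hlt | hgt
    · exact ⟨some v, mem_eliminationBag_some.2 (.inr ⟨huv.symm, hlt⟩),
        mem_eliminationBag_some.2 (.inl rfl)⟩
    · exact ⟨some u, mem_eliminationBag_some.2 (.inl rfl),
        mem_eliminationBag_some.2 (.inr ⟨huv, hgt⟩)⟩
  inter_subset a s b p hp hs x ha hb := by
    refine isPathConvex_of_forall_exists_walk (S := {t | x ∈ eliminationBag G L t}) (c := some x)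
      (eliminationTree_isTree G L).2 ?_ ha hb p hp s hs
    rintro (_ | v) hv
    · simp [eliminationBag] at hv
    · exact h.exists_walk_of_mem_eliminationBag v hv

theorem card_eliminationBag_le (h : IsEliminationOrder G L k) (t : Option V) :
    (eliminationBag G L t).card ≤ k + 1 := by
  classical
  rcases t with _ | v
  · simp [eliminationBag]
  · calc (eliminationBag G L (some v)).card
        ≤ (Set.toFinite (earlierNeighbors G L v)).toFinset.card + 1 := Finset.card_insert_le _ _
      _ = (earlierNeighbors G L v).ncard + 1 := by rw [Set.ncard_eq_toFinset_card]
      _ ≤ k + 1 := Nat.succ_le_succ (h.ncard_le v)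

theorem treewidthAtMost {V : Type} [Finite V] {G : SimpleGraph V} {L : V ↪ ℕ}
    (h : IsEliminationOrder G L k) : G.TreewidthAtMost k :=
  ⟨Option V, inferInstance, eliminationTree G L, h.treeDecomposition, h.card_eliminationBag_le⟩

theorem treewidth_eq {V : Type} [Finite V] {G : SimpleGraph V} {L : V ↪ ℕ}
    (h : IsEliminationOrder G L k) (hG : ¬ G.CliqueFree (k + 1)) : G.treewidth = k := by
  have hattained : G.TreewidthAtMost G.treewidth :=
    Nat.sInf_mem (s := {m | G.TreewidthAtMost m}) ⟨k, h.treewidthAtMost⟩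
  exact le_antisymm (Nat.sInf_le h.treewidthAtMost)
    (le_of_treewidthAtMost_of_not_cliqueFree hattained hG)

end IsEliminationOrder

end EliminationTree

section WReach

variable {V V' : Type*} {G : SimpleGraph V} {G' : SimpleGraph V'} {r : ℕ}

theorem mem_wReach_of_walk {L : V → ℕ} {u v : V} (p : G.Walk v u) (hlen : p.length ≤ r)
    (hmin : ∀ w ∈ p.support, L u ≤ L w) : u ∈ G.WReach L r v := by
  classical
  exact ⟨p.bypass, p.bypass_isPath, p.length_bypass_le_length.trans hlen,
    fun w hw => hmin w (p.support_bypass_subset_support hw)⟩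

theorem self_mem_wReach (L : V → ℕ) (r : ℕ) (v : V) : v ∈ G.WReach L r v :=
  mem_wReach_of_walk Walk.nil (Nat.zero_le r) (by simp)

theorem mem_wReach_succ_of_adj {L : V → ℕ} {u v w : V} (hvw : G.Adj v w) (hle : L u ≤ L v)
    (hu : u ∈ G.WReach L r w) : u ∈ G.WReach L (r + 1) v := by
  obtain ⟨p, -, hlen, hmin⟩ := hu
  exact mem_wReach_of_walk (Walk.cons hvw p) (Nat.succ_le_succ hlen)
    (List.forall_mem_cons.2 ⟨hle, hmin⟩)

theorem le_of_mem_wReach {L : V → ℕ} {u v : V} (hu : u ∈ G.WReach L r v) : L u ≤ L v := by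
  obtain ⟨p, -, -, hmin⟩ := hu
  exact hmin v p.start_mem_support

theorem map_mem_wReach (f : G →g G') {L : V' → ℕ} {u v : V} (hu : u ∈ G.WReach (L ∘ f) r v) :
    f u ∈ G'.WReach L r (f v) := by
  obtain ⟨p, -, hlen, hmin⟩ := hu
  exact mem_wReach_of_walk (p.map f) (by rwa [Walk.length_map]) (by simpa using hmin)

theorem ncard_wReach_le_of_embedding [Finite V'] (f : G ↪g G') (L : V' → ℕ) (r : ℕ) (v : V) :
    (G.WReach (L ∘ f) r v).ncard ≤ (G'.WReach L r (f v)).ncard :=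
  Set.ncard_le_ncard_of_injOn f (fun _ hu => map_mem_wReach f.toHom hu) f.injective.injOn

end WReach

section Wcol

variable {V : Type*} [Fintype V] {G : SimpleGraph V} {c r : ℕ}

theorem le_wcol (h : ∀ L : V ↪ ℕ, ∃ v, c ≤ (G.WReach L r v).ncard) : c ≤ G.wcol r := by
  have : Nonempty (V ↪ ℕ) := ⟨(Fintype.equivFin V).toEmbedding.trans Fin.valEmbedding⟩
  refine le_ciInf fun L => ?_
  obtain ⟨v, hv⟩ := h L
  exact hv.trans (Finset.le_sup (f := fun v => (G.WReach L r v).ncard) (Finset.mem_univ v))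

theorem exists_wcol_le_ncard_wReach [Nonempty V] (G : SimpleGraph V) (L : V ↪ ℕ) (r : ℕ) :
    ∃ v, G.wcol r ≤ (G.WReach L r v).ncard := by
  obtain ⟨v, -, hv⟩ := Finset.exists_mem_eq_sup Finset.univ Finset.univ_nonempty
    fun v => (G.WReach L r v).ncard
  exact ⟨v, hv ▸ ciInf_le' _ L⟩

theorem one_le_wcol [Nonempty V] (G : SimpleGraph V) (r : ℕ) : 1 ≤ G.wcol r :=
  le_wcol fun L => ⟨Classical.arbitrary V,
    (Set.ncard_pos (Set.toFinite _)).2 ⟨_, self_mem_wReach L r _⟩⟩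

theorem wcol_le_wcol_of_embedding {V' : Type*} [Fintype V'] {G' : SimpleGraph V'}
    (f : G ↪g G') (r : ℕ) : G.wcol r ≤ G'.wcol r := by
  cases isEmpty_or_nonempty V
  · simp [wcol]
  refine le_wcol fun L => ?_
  obtain ⟨v, hv⟩ := exists_wcol_le_ncard_wReach G (f.toEmbedding.trans L) r
  exact ⟨f v, hv.trans (ncard_wReach_le_of_embedding f L r v)⟩

end Wcol

section AttachCopies

/-- The graph obtained from `G` by attaching to each vertex `x` one disjoint copy of `H` for each
index in `ι`, all of whose vertices are joined to `x`; that is, the corona product of `G` with the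
disjoint union of `ι` copies of `H`. The vertex `.inr ((x, i), w)` is the vertex `w` of the `i`-th
copy attached to `x`. -/
def attachCopies {V W : Type*} (G : SimpleGraph V) (H : SimpleGraph W) (ι : Type*) :
    SimpleGraph (V ⊕ (V × ι) × W) where
  Adj
    | .inl a, .inl b => G.Adj a b
    | .inl a, .inr (y, _) => y.1 = a
    | .inr (y, _), .inl a => y.1 = a
    | .inr (y, w), .inr (y', w') => y = y' ∧ H.Adj w w'
  symm := ⟨by
    rintro (a | ⟨y, w⟩) (b | ⟨y', w'⟩) h
    · exact Adj.symm h
    · exact h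
    · exact h
    · exact ⟨h.1.symm, Adj.symm h.2⟩⟩
  loopless := ⟨by
    rintro (a | ⟨y, w⟩) h
    · exact G.irrefl h
    · exact H.irrefl h.2⟩

variable {V W ι : Type*} {G : SimpleGraph V} {H : SimpleGraph W}

/-- The inclusion of the base graph into `attachCopies G H ι`. -/
def baseEmbedding (G : SimpleGraph V) (H : SimpleGraph W) (ι : Type*) :
    G ↪g attachCopies G H ι :=
  ⟨Function.Embedding.inl, Iff.rfl⟩

/-- The inclusion of the copy of `H` with index `y.2` attached to the vertex `y.1`. -/
def copyEmbedding (G : SimpleGraph V) (H : SimpleGraph W) (y : V × ι) :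
    H ↪g attachCopies G H ι :=
  ⟨(Function.Embedding.sectR y W).trans Function.Embedding.inr,
    ⟨fun h => h.2, fun h => ⟨rfl, h⟩⟩⟩

/-- The order on the vertices of `attachCopies G H ι` induced by orders of `V`, `ι` and `W`. It is
encoded by `2 * L a` on the base and `2 * pair (pair (L x) (K i)) (M w) + 1` on the copies, so that
each copy comes after the base vertex to which it is attached. -/
def attachOrder (L : V ↪ ℕ) (K : ι ↪ ℕ) (M : W ↪ ℕ) : V ⊕ (V × ι) × W ↪ ℕ :=
  (L.sumMap ((((L.prodMap K).trans Nat.pairEquiv.toEmbedding).prodMap M).trans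
    Nat.pairEquiv.toEmbedding)).trans Equiv.natSumNatEquivNat.toEmbedding

section attachOrder

variable (L : V ↪ ℕ) (K : ι ↪ ℕ) (M : W ↪ ℕ)

theorem attachOrder_inl_lt_inl {a b : V} :
    attachOrder L K M (.inl a) < attachOrder L K M (.inl b) ↔ L a < L b := by
  simp [attachOrder]

theorem attachOrder_inl_lt_inr (y : V × ι) (w : W) :
    attachOrder L K M (.inl y.1) < attachOrder L K M (.inr (y, w)) := by
  have h : L y.1 ≤ Nat.pair (Nat.pair (L y.1) (K y.2)) (M w) :=
    (Nat.left_le_pair _ _).trans (Nat.left_le_pair _ _)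
  simpa [attachOrder, Function.uncurry, Nat.lt_succ_iff] using h

theorem attachOrder_inr_lt_inr {y : V × ι} {w z : W} :
    attachOrder L K M (.inr (y, w)) < attachOrder L K M (.inr (y, z)) ↔ M w < M z := by
  have h : StrictMono (Nat.pair (Nat.pair (L y.1) (K y.2))) := fun _ _ => Nat.pair_lt_pair_right _
  simpa [attachOrder, Function.uncurry] using h.lt_iff_lt

theorem earlierNeighbors_attachCopies_inl (v : V) :
    earlierNeighbors (attachCopies G H ι) (attachOrder L K M) (.inl v) =
      baseEmbedding G H ι '' earlierNeighbors G L v := by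
  ext (a | ⟨y, w⟩)
  · calc _ ↔ a ∈ earlierNeighbors G L v := and_congr Iff.rfl (attachOrder_inl_lt_inl L K M)
      _ ↔ _ := (Function.Injective.mem_set_image (baseEmbedding G H ι).injective).symm
  · refine ⟨?_, fun ⟨_, _, h⟩ => absurd h Sum.inl_ne_inr⟩
    rintro ⟨rfl, hlt⟩
    exact absurd hlt (attachOrder_inl_lt_inr L K M y w).not_gt

theorem earlierNeighbors_attachCopies_inr (y : V × ι) (w : W) :
    earlierNeighbors (attachCopies G H ι) (attachOrder L K M) (.inr (y, w)) =
      insert (.inl y.1) (copyEmbedding G H y '' earlierNeighbors H M w) := by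
  ext (a | ⟨y', z⟩)
  · constructor
    · rintro ⟨rfl, -⟩
      exact Set.mem_insert _ _
    · rintro (h | ⟨_, -, h⟩)
      · obtain rfl := Sum.inl_injective h
        exact ⟨rfl, attachOrder_inl_lt_inr L K M y w⟩
      · exact absurd h Sum.inr_ne_inl
  · constructor
    · rintro ⟨⟨rfl, hwz⟩, hlt⟩
      exact .inr ⟨z, ⟨hwz, (attachOrder_inr_lt_inr L K M).1 hlt⟩, rfl⟩
    · rintro (h | ⟨_, ⟨hwz, hlt⟩, h⟩)
      · exact absurd h Sum.inr_ne_inl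
      · cases h
        exact ⟨⟨rfl, hwz⟩, (attachOrder_inr_lt_inr L K M).2 hlt⟩

end attachOrder

theorem isClique_image_of_hom (f : G →g H) {s : Set V} (hs : G.IsClique s) :
    H.IsClique (f '' s) := by
  rintro _ ⟨a, ha, rfl⟩ _ ⟨b, hb, rfl⟩ hab
  exact f.map_adj (hs ha hb (ne_of_apply_ne f hab))

theorem IsEliminationOrder.attachCopies {k : ℕ} {L : V ↪ ℕ} {M : W ↪ ℕ}
    (hG : IsEliminationOrder G L (k + 1)) (hH : IsEliminationOrder H M k) (K : ι ↪ ℕ) :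
    IsEliminationOrder (attachCopies G H ι) (attachOrder L K M) (k + 1) where
  isClique := by
    rintro (v | ⟨y, w⟩)
    · rw [earlierNeighbors_attachCopies_inl]
      exact isClique_image_of_hom (baseEmbedding G H ι).toHom (hG.isClique v)
    · rw [earlierNeighbors_attachCopies_inr, isClique_insert]
      refine ⟨isClique_image_of_hom (copyEmbedding G H y).toHom (hH.isClique w), ?_⟩
      rintro _ ⟨z, -, rfl⟩ -
      rfl
  ncard_le := by
    rintro (v | ⟨y, w⟩)
    · rw [earlierNeighbors_attachCopies_inl,
        Set.ncard_image_of_injective _ (RelEmbedding.injective _)]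
      exact hG.ncard_le v
    · rw [earlierNeighbors_attachCopies_inr]
      refine (Set.ncard_insert_le _ _).trans (Nat.succ_le_succ ?_)
      rw [Set.ncard_image_of_injective _ (RelEmbedding.injective _)]
      exact hH.ncard_le w

section Finite

variable [Finite V] [Finite W] [Finite ι]

theorem card_le_ncard_wReach_attachCopies {L : V ⊕ (V × ι) × W → ℕ} {x : V}
    (h : ∀ i, ∃ w, L (.inr ((x, i), w)) ≤ L (.inl x)) (r : ℕ) :
    Nat.card ι ≤ ((attachCopies G H ι).WReach L (r + 1) (.inl x)).ncard := by
  choose w hw using h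
  have hinj : Function.Injective fun i => (.inr ((x, i), w i) : V ⊕ (V × ι) × W) :=
    fun i j hij => congrArg (fun z => z.1.2) (Sum.inr_injective hij)
  rw [← Set.ncard_univ, ← Set.ncard_image_of_injective _ hinj, Set.image_univ]
  refine Set.ncard_le_ncard (Set.range_subset_iff.2 fun i => ?_)
  have hadj : (attachCopies G H ι).Adj (.inl x) (.inr ((x, i), w i)) := rfl
  exact mem_wReach_succ_of_adj hadj (hw i) (self_mem_wReach L r _)

theorem ncard_wReach_add_ncard_wReach_le {L : V ⊕ (V × ι) × W → ℕ} {y : V × ι}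
    (h : ∀ w, L (.inl y.1) ≤ L (.inr (y, w))) (r : ℕ) (w : W) :
    (G.WReach (L ∘ baseEmbedding G H ι) r y.1).ncard +
        (H.WReach (L ∘ copyEmbedding G H y) (r + 1) w).ncard ≤
      ((attachCopies G H ι).WReach L (r + 1) (.inr (y, w))).ncard := by
  rw [← Set.ncard_image_of_injective _ (baseEmbedding G H ι).injective,
    ← Set.ncard_image_of_injective _ (copyEmbedding G H y).injective, ← Set.ncard_union_eq]
  · refine Set.ncard_le_ncard (Set.union_subset ?_ ?_)
    · rintro _ ⟨u, hu, rfl⟩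
      have hadj : (attachCopies G H ι).Adj (.inr (y, w)) (baseEmbedding G H ι y.1) := rfl
      exact mem_wReach_succ_of_adj hadj ((le_of_mem_wReach hu).trans (h w))
        (map_mem_wReach (baseEmbedding G H ι).toHom hu)
    · rintro _ ⟨u, hu, rfl⟩
      exact map_mem_wReach (copyEmbedding G H y).toHom hu
  · rw [Set.disjoint_left]
    rintro _ ⟨u, -, rfl⟩ ⟨z, -, hz⟩
    exact Sum.inr_ne_inl hz

end Finite

theorem wcol_add_wcol_le_wcol_attachCopies [Fintype V] [Fintype W] [Fintype ι] [Nonempty V]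
    [Nonempty W] {r : ℕ} (hcard : G.wcol r + H.wcol (r + 1) ≤ Fintype.card ι) :
    G.wcol r + H.wcol (r + 1) ≤ (attachCopies G H ι).wcol (r + 1) := by
  refine le_wcol fun L => ?_
  obtain ⟨x, hx⟩ := exists_wcol_le_ncard_wReach G ((baseEmbedding G H ι).toEmbedding.trans L) r
  by_cases hi : ∃ i, ∀ w, L (.inl x) ≤ L (.inr ((x, i), w))
  · obtain ⟨i, hi⟩ := hi
    obtain ⟨w, hw⟩ := exists_wcol_le_ncard_wReach H
      ((copyEmbedding G H (x, i)).toEmbedding.trans L) (r + 1)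
    exact ⟨_, (add_le_add hx hw).trans (ncard_wReach_add_ncard_wReach_le (y := (x, i)) hi r w)⟩
  · push Not at hi
    refine ⟨.inl x, hcard.trans ?_⟩
    rw [← Nat.card_eq_fintype_card]
    exact card_le_ncard_wReach_attachCopies (fun i => (hi i).imp fun _ => le_of_lt) r

end AttachCopies

section Extremal

/-- `G` witnesses the sharpness of the bound `wcol r' ≤ (r' + k).choose k` for treewidth `k` and
all `r' ≤ r`. -/
structure IsExtremal {V : Type*} [Fintype V] (G : SimpleGraph V) (k r : ℕ) : Prop where
  exists_isEliminationOrder : ∃ L : V ↪ ℕ, IsEliminationOrder G L k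
  not_cliqueFree : ¬ G.CliqueFree (k + 1)
  choose_le_wcol : ∀ r' ≤ r, (r' + k).choose k ≤ G.wcol r'

namespace IsExtremal

variable {V W : Type*} [Fintype V] [Fintype W] {G : SimpleGraph V} {H : SimpleGraph W} {k r : ℕ}

theorem wcol_eq (h : IsExtremal G k r) {r' : ℕ} (hr' : r' ≤ r) :
    G.wcol r' = (r' + k).choose k :=
  let ⟨_, hL⟩ := h.exists_isEliminationOrder
  (hL.wcol_le r').antisymm (h.choose_le_wcol r' hr')

theorem treewidth_eq {V : Type} [Fintype V] {G : SimpleGraph V} (h : IsExtremal G k r) :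
    G.treewidth = k :=
  let ⟨_, hL⟩ := h.exists_isEliminationOrder
  hL.treewidth_eq h.not_cliqueFree

theorem nonempty (h : IsExtremal G k r) : Nonempty V :=
  not_isEmpty_iff.1 fun _ => h.not_cliqueFree (cliqueFree_of_card_lt (by simp))

theorem top (h : ∀ r' ≤ r, (r' + k).choose k ≤ 1) :
    IsExtremal (⊤ : SimpleGraph (Fin (k + 1))) k r where
  exists_isEliminationOrder := ⟨_, isEliminationOrder_top k⟩
  not_cliqueFree := (not_cliqueFree_iff_top_isContained _).2 (.refl _)
  choose_le_wcol r' hr' := (h r' hr').trans (one_le_wcol _ r')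

theorem attachCopies {N : ℕ} (hG : IsExtremal G (k + 1) r) (hH : IsExtremal H k (r + 1))
    (hN : (r + 1 + (k + 1)).choose (k + 1) ≤ N) :
    IsExtremal (attachCopies G H (Fin N)) (k + 1) (r + 1) where
  exists_isEliminationOrder :=
    let ⟨_, hL⟩ := hG.exists_isEliminationOrder
    let ⟨_, hM⟩ := hH.exists_isEliminationOrder
    ⟨_, hL.attachCopies hM Fin.valEmbedding⟩
  not_cliqueFree := mt (CliqueFree.comap (baseEmbedding G H (Fin N)).isContained) hG.not_cliqueFree
  choose_le_wcol r' hr' := by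
    have := hG.nonempty
    have := hH.nonempty
    rcases hr'.lt_or_eq with hlt | rfl
    · exact (hG.choose_le_wcol r' (Nat.le_of_lt_succ hlt)).trans
        (wcol_le_wcol_of_embedding (baseEmbedding G H (Fin N)) r')
    · have hsum : G.wcol r + H.wcol (r + 1) = (r + 1 + (k + 1)).choose (k + 1) := by
        rw [choose_add_succ, hG.wcol_eq le_rfl, hH.wcol_eq le_rfl]
      rw [← hsum]
      exact wcol_add_wcol_le_wcol_attachCopies (by rwa [hsum, Fintype.card_fin])

end IsExtremal

theorem exists_isExtremal (k r : ℕ) :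
    ∃ (V : Type) (_ : Fintype V) (G : SimpleGraph V), IsExtremal G k r := by
  induction k generalizing r with
  | zero => exact ⟨_, inferInstance, _, .top (by simp)⟩
  | succ k ihk =>
    induction r with
    | zero => exact ⟨_, inferInstance, _, .top (by simp)⟩
    | succ r ihr =>
      obtain ⟨V, _, G, hG⟩ := ihr
      obtain ⟨W, _, H, hH⟩ := ihk (r + 1)
      exact ⟨_, inferInstance, _, hG.attachCopies hH le_rfl⟩

end Extremal

end WeakColouring

theorem mainTheorem4 (k r : ℕ) :
    ∃ (V : Type) (_ : Fintype V) (G : SimpleGraph V),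
      G.treewidth = k ∧ ∀ r' : ℕ, r' ≤ r → G.wcol r' = (r' + k).choose k := by
  obtain ⟨V, _, G, hG⟩ := WeakColouring.exists_isExtremal k r
  exact ⟨V, inferInstance, G, hG.treewidth_eq, fun _ => hG.wcol_eq⟩
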